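/- Consider a queue with infinite waiting room, Poisson arrivals of rate $\lambda>0$, and $K$ groups of parallel exponential servers; group $k$ has $M_k$ servers, each with service rate $\mu_k>0$ and operating cost rate $c_k\in\mathbb R$ while working. With $n$ customers in the system (including those in service) the holding cost rate is $h(n)$, where $h:\mathbb N\to\mathbb R$ is nondecreasing and convex and $h(n)\to\infty$. An efficient policy $d$ assigns to every $n\in\mathbb N$ numbers $d(n,k)\in\{0,\dots,M_k\}$ of working servers with $\|d(n)\|_1=\sum_k d(n,k)\le n$. Under $d$ the number of customers $n_t$ is the continuous-time Markov chain on $\mathbb N$ with birth rate $\lambda$ and death rate $\sum_k d(n,k)\mu_k$ in state $n$; let $B$ be its generator. The cost rate in state $n$ is $f(n)=h(n)+\sum_k d(n,k)c_k$, and the long-run average cost is $\eta^d=\lim_{T\to\infty}\frac1T\,\mathbb E\int_0^T f(n_t)\,dt$ (from every initial state). Let $d^*$ be an optimal policy, i.e. an efficient policy whose average cost $\eta^*$ is finite and minimal among all efficient policies. Let $g^*$ be its performance potential, i.e. a solution (unique up to an additive constant) of the Poisson equation $f-\eta^*\mathbf 1+Bg^*=0$ for $d^*$, and let $G^*(n)=g^*(n)-g^*(n-1)$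 for $n\ge1$. Then: (a) $\|d^*(n)\|_1\le\|d^*(n+1)\|_1$ for all $n\in\mathbb N$. (b) For every $n\ge1$, if $d^*(n,k)=0$ for every $k$ with $G^*(n)=c_k/\mu_k$ (in particular, if there is no such $k$), then $$\|d^*(n)\|_1=n\wedge\sum_{k\in\mathbb K^*_n}M_k,\qquad \mathbb K^*_n=\{k: G^*(n)>c_k/\mu_k\}.$$ (c) Without that convention on ties, for every $n\ge1$, $$n\wedge\sum_{k:\,G^*(n)>c_k/\mu_k}M_k\ \le\ \|d^*(n)\|_1\ \le\ n\wedge\sum_{k:\,G^*(n)\ge c_k/\mu_k}M_k .$$ -/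

import Mathlib

open Filter Topology

noncomputable section

/-- The data of a group-server queue with `K` groups of parallel exponential servers: Poisson
arrivals of rate `lam`; group `k` has `M k` servers, each of service rate `mu k` and of operating
cost rate `c k` while it works; `h n` is the holding cost rate with `n` customers present, a
(weakly) increasing convex function on `ℕ` that tends to infinity. -/
structure GroupServerQueue (K : ℕ) where
  lam : ℝ
  M : Fin K → ℕ
  mu : Fin K → ℝ
  c : Fin K → ℝ
  h : ℕ → ℝ
  lam_pos : 0 < lam
  mu_pos : ∀ k, 0 < mu k
  h_mono : Monotone h
  h_convex : ∀ n, h (n + 1) - h n ≤ h (n + 2) - h (n + 1)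
  h_tendsto : Tendsto h atTop atTop

namespace GroupServerQueue

variable {K : ℕ} (Q : GroupServerQueue K)

/-- The total number of working servers under the scheduling action `m`. -/
def total (m : Fin K → ℕ) : ℕ := ∑ k, m k

/-- The total service rate under the action `m`. -/
def rate (m : Fin K → ℕ) : ℝ := ∑ k, (m k : ℝ) * Q.mu k

/-- The cost rate `f (n, m)`: holding cost plus operating cost. -/
def cost (n : ℕ) (m : Fin K → ℕ) : ℝ := Q.h n + ∑ k, (m k : ℝ) * Q.c k

/-- A stationary policy `d : ℕ → (Fin K → ℕ)` is efficient if `d n k ≤ M k` and if at most `n`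
servers work in state `n`. -/
def IsEfficient (d : ℕ → Fin K → ℕ) : Prop :=
  ∀ n, (∀ k, d n k ≤ Q.M k) ∧ total (d n) ≤ n

/-- The infinitesimal generator of the number of customers under `d`, acting on functions:
a birth-death generator with birth rate `lam` and death rate `rate (d n)` in state `n`.
(In state `0` the term with the death rate vanishes.) -/
def gen (d : ℕ → Fin K → ℕ) (u : ℕ → ℝ) (n : ℕ) : ℝ :=
  Q.lam * (u (n + 1) - u n) + Q.rate (d n) * (u (n - 1) - u n)

/-- A uniform bound for the exit rates. -/
def unifRate : ℝ := Q.lam + ∑ k, (Q.M k : ℝ) * Q.mu k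

/-- The one-step operator `I + B / Λ` of the uniformized jump chain, where `B` is the generator
and `Λ` is `unifRate`. -/
def step (d : ℕ → Fin K → ℕ) (u : ℕ → ℝ) (n : ℕ) : ℝ :=
  u n + Q.gen d u n / Q.unifRate

/-- The transition probability `P (n_t = j | n_0 = i)` of the continuous-time Markov chain with the
(bounded) generator `B`, that is the `(i, j)` entry of
`exp (t B) = ∑ r, exp (- Λ t) * (Λ t) ^ r / r! * (I + B / Λ) ^ r`. -/
def transProb (d : ℕ → Fin K → ℕ) (t : ℝ) (i j : ℕ) : ℝ :=
  ∑' r : ℕ, Real.exp (-(Q.unifRate * t)) * (Q.unifRate * t) ^ r / (r.factorial : ℝ)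
    * ((Q.step d)^[r] (Pi.single j 1)) i

/-- The expected cost rate `E [f (n_t, d (n_t)) | n_0 = i]` at time `t`. -/
def expectedCost (d : ℕ → Fin K → ℕ) (t : ℝ) (i : ℕ) : ℝ :=
  ∑' j : ℕ, Q.transProb d t i j * Q.cost j (d j)

/-- The long-run average cost of `d` exists, is finite and equals `η`, from every initial
state: all expectations are finite and `(1 / T) * E ∫₀ᵀ f (n_t, d (n_t)) dt` tends to `η`. -/
def HasAverageCost (d : ℕ → Fin K → ℕ) (η : ℝ) : Prop :=
  ∀ i : ℕ,
    (∀ t : ℝ, 0 ≤ t → Summable fun j : ℕ => Q.transProb d t i j * Q.cost j (d j)) ∧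
    (∀ T : ℝ, 0 ≤ T →
      IntervalIntegrable (fun t => Q.expectedCost d t i) MeasureTheory.volume 0 T) ∧
    Tendsto (fun T : ℝ => 1 / T * ∫ t in (0 : ℝ)..T, Q.expectedCost d t i) atTop (𝓝 η)

/-- `d` is optimal: it is efficient, its long-run average cost is finite, and no efficient policy
has a smaller one. (The cost rate is bounded below, so a policy to which `HasAverageCost` gives
no value has infinite cost.) -/
def IsOptimal (d : ℕ → Fin K → ℕ) : Prop :=
  Q.IsEfficient d ∧ ∃ η, Q.HasAverageCost d η ∧
    ∀ d' η', Q.IsEfficient d' → Q.HasAverageCost d' η' → η ≤ η'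

/-- `g` is a performance potential (relative value function) of the policy `d` of average cost
`η`: a solution of the Poisson equation `f - η 1 + B g = 0`. Such a `g` exists and is unique up to
an additive constant, the free choice of `g 0`. -/
def IsPotential (d : ℕ → Fin K → ℕ) (η : ℝ) (g : ℕ → ℝ) : Prop :=
  ∀ n, Q.cost n (d n) - η + Q.gen d g n = 0

/-- The perturbation realization factor `G n = g n - g (n - 1)`, for `n ≥ 1`. (The value `0`
that this expression gives at `n = 0` plays no role: no server works in state `0`.) -/
def prf (g : ℕ → ℝ) (n : ℕ) : ℝ := g n - g (n - 1)

end GroupServerQueue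

end

/-!
For a birth-death chain that is busy outside `0`, detailed balance gives the stationary law, and
the time averages of any cost with a finite stationary mean converge to that mean. Hence a policy
that eventually agrees with an optimal one, and whose Poisson inequality holds with increments `G`
of a trial potential, would have a smaller average cost unless the inequality is an equality
everywhere. With `G = prf g` and a change of the action in a single state, this shows that the
optimal action in state `n` maximizes the gain `∑ k, m k * (prf g n * μ k - c k)` over the feasible
actions. Such a maximizer employs all the servers with `c k / μ k < prf g n` that the queue can
occupy, and no server with `c k / μ k > prf g n`.

Monotonicity of `‖d n‖₁` in `n` thus reduces to strict monotonicity of `prf g`. This follows from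
the optimality equation `λ * prf g (n + 1) = η - h n + maxGain n (prf g n)` and the convexity of
`h`: a first descent of `prf g` would persist, which contradicts `h n → ∞`.
-/

noncomputable section

/-! ### Poisson means -/

theorem hasDerivAt_pow_succ_div_factorial (r : ℕ) (x : ℝ) :
    HasDerivAt (fun y : ℝ => y ^ (r + 1) / (r + 1).factorial) (x ^ r / r.factorial) x := by
  refine ((hasDerivAt_pow (r + 1) x).div_const _).congr_deriv ?_
  rw [Nat.factorial_succ, Nat.add_sub_cancel]
  push_cast
  exact mul_div_mul_left _ _ (Nat.cast_add_one_ne_zero r)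

theorem norm_pow_div_factorial_mul_le {a : ℕ → ℝ} {C R x : ℝ} (ha : ∀ r, |a r| ≤ C) (hx : |x| ≤ R)
    (r s : ℕ) : ‖x ^ r / r.factorial * a s‖ ≤ R ^ r / r.factorial * C := by
  have hR : 0 ≤ R := (abs_nonneg x).trans hx
  rw [norm_mul, norm_div, norm_pow, Real.norm_natCast, Real.norm_eq_abs, Real.norm_eq_abs]
  gcongr
  exact ha s

theorem summable_pow_div_factorial_mul {a : ℕ → ℝ} {C : ℝ} (ha : ∀ r, |a r| ≤ C) (x : ℝ) :
    Summable fun r => x ^ r / r.factorial * a r :=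
  ((Real.summable_pow_div_factorial |x|).mul_right C).of_norm_bounded fun r =>
    norm_pow_div_factorial_mul_le ha le_rfl r r

theorem hasDerivAt_tsum_pow_div_factorial_mul {a : ℕ → ℝ} {C : ℝ} (ha : ∀ r, |a r| ≤ C) (x : ℝ) :
    HasDerivAt (fun y : ℝ => ∑' r : ℕ, y ^ r / r.factorial * a r)
      (∑' r : ℕ, x ^ r / r.factorial * a (r + 1)) x := by
  have hsplit : (fun y : ℝ => ∑' r : ℕ, y ^ r / r.factorial * a r) = fun y =>
      a 0 + ∑' r : ℕ, y ^ (r + 1) / (r + 1).factorial * a (r + 1) := by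
    funext y
    rw [(summable_pow_div_factorial_mul ha y).tsum_eq_zero_add]
    simp
  have hx : x ∈ Metric.ball (0 : ℝ) (|x| + 1) := by simp
  rw [hsplit]
  refine HasDerivAt.const_add _ (hasDerivAt_tsum_of_isPreconnected
    ((Real.summable_pow_div_factorial (|x| + 1)).mul_right C) Metric.isOpen_ball
    (convex_ball (0 : ℝ) (|x| + 1)).isPreconnected
    (fun r y _ => (hasDerivAt_pow_succ_div_factorial r y).mul_const _) (fun r y hy => ?_) hx
    ((summable_nat_add_iff 1).2 (summable_pow_div_factorial_mul ha x)) hx)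
  exact norm_pow_div_factorial_mul_le ha (mem_ball_zero_iff.1 hy).le r (r + 1)

/-- The mean of the sequence `a` under the Poisson distribution of parameter `x`. -/
def poissonMean (a : ℕ → ℝ) (x : ℝ) : ℝ :=
  ∑' r : ℕ, Real.exp (-x) * x ^ r / (r.factorial : ℝ) * a r

theorem hasDerivAt_poissonMean {a : ℕ → ℝ} {C : ℝ} (ha : ∀ r, |a r| ≤ C) (x : ℝ) :
    HasDerivAt (poissonMean a) (poissonMean (fun r => a (r + 1)) x - poissonMean a x) x := by
  have hfactor (b : ℕ → ℝ) (y : ℝ) :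
      poissonMean b y = Real.exp (-y) * ∑' r : ℕ, y ^ r / r.factorial * b r := by
    rw [poissonMean, ← tsum_mul_left]
    exact tsum_congr fun r => by ring
  rw [hfactor, hfactor, show poissonMean a = _ from funext (hfactor a)]
  exact ((hasDerivAt_neg x).exp.mul (hasDerivAt_tsum_pow_div_factorial_mul ha x)).congr_deriv
    (by ring)

theorem poissonWeight_nonneg {x : ℝ} (hx : 0 ≤ x) (r : ℕ) :
    0 ≤ Real.exp (-x) * x ^ r / (r.factorial : ℝ) := by
  positivity

theorem hasSum_poissonWeight (x : ℝ) :
    HasSum (fun r : ℕ => Real.exp (-x) * x ^ r / (r.factorial : ℝ)) 1 := by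
  have h := (NormedSpace.expSeries_div_hasSum_exp x).mul_left (Real.exp (-x))
  rw [← Real.exp_eq_exp_ℝ, ← Real.exp_add, neg_add_cancel, Real.exp_zero] at h
  exact h.congr_fun fun r => mul_div_assoc _ _ _

theorem summable_poissonWeight_mul {a : ℕ → ℝ} {C : ℝ} (ha : ∀ r, |a r| ≤ C) (x : ℝ) :
    Summable fun r : ℕ => Real.exp (-x) * x ^ r / (r.factorial : ℝ) * a r :=
  ((summable_pow_div_factorial_mul ha x).mul_left (Real.exp (-x))).congr fun r => by ring

theorem poissonMean_const (b x : ℝ) : poissonMean (fun _ => b) x = b := by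
  rw [poissonMean, tsum_mul_right, (hasSum_poissonWeight x).tsum_eq, one_mul]

theorem poissonMean_mono {a b : ℕ → ℝ} {C D x : ℝ} (ha : ∀ r, |a r| ≤ C) (hb : ∀ r, |b r| ≤ D)
    (hx : 0 ≤ x) (hab : ∀ r, a r ≤ b r) : poissonMean a x ≤ poissonMean b x :=
  (summable_poissonWeight_mul ha x).tsum_le_tsum
    (fun r => mul_le_mul_of_nonneg_left (hab r) (poissonWeight_nonneg hx r))
    (summable_poissonWeight_mul hb x)

theorem poissonMean_sub {a b : ℕ → ℝ} {C D : ℝ} (ha : ∀ r, |a r| ≤ C) (hb : ∀ r, |b r| ≤ D)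
    (x : ℝ) : poissonMean (fun r => a r - b r) x = poissonMean a x - poissonMean b x := by
  simp only [poissonMean, mul_sub]
  exact (summable_poissonWeight_mul ha x).tsum_sub (summable_poissonWeight_mul hb x)

theorem poissonMean_const_mul (b : ℝ) (a : ℕ → ℝ) (x : ℝ) :
    poissonMean (fun r => b * a r) x = b * poissonMean a x := by
  simp only [poissonMean, mul_left_comm _ b, tsum_mul_left]

/-! ### Birth-death chains -/

/-- A continuous-time birth-death chain on `ℕ` with bounded rates. The chain is uniformized:
`bound` is the rate of the Poisson clock that triggers its (possibly void) jumps. -/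
structure BirthDeathChain where
  birth : ℕ → ℝ
  death : ℕ → ℝ
  bound : ℝ
  birth_pos : ∀ n, 0 < birth n
  death_nonneg : ∀ n, 0 ≤ death n
  death_zero : death 0 = 0
  birth_add_death_le : ∀ n, birth n + death n ≤ bound

namespace BirthDeathChain

variable (C : BirthDeathChain)

theorem bound_pos : 0 < C.bound :=
  (add_pos_of_pos_of_nonneg (C.birth_pos 0) (C.death_nonneg 0)).trans_le (C.birth_add_death_le 0)

theorem birth_le (n : ℕ) : C.birth n ≤ C.bound := by
  linarith [C.birth_add_death_le n, C.death_nonneg n]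

theorem death_le (n : ℕ) : C.death n ≤ C.bound := by
  linarith [C.birth_add_death_le n, C.birth_pos n]

/-- The generator of the chain, acting on functions. -/
def gen (u : ℕ → ℝ) (n : ℕ) : ℝ :=
  C.birth n * (u (n + 1) - u n) + C.death n * (u (n - 1) - u n)

/-- The transition operator `I + B / bound` of the uniformized jump chain, where `B` is the
generator. -/
def step : Module.End ℝ (ℕ → ℝ) where
  toFun u n := u n + C.gen u n / C.bound
  map_add' u v := by
    funext n
    simp only [gen, Pi.add_apply]
    ring
  map_smul' a u := by
    funext n
    simp only [gen, Pi.smul_apply, smul_eq_mul, RingHom.id_apply]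
    ring

theorem step_apply (u : ℕ → ℝ) (n : ℕ) : C.step u n = u n + C.gen u n / C.bound := rfl

theorem step_apply_eq_convex_combination (u : ℕ → ℝ) (n : ℕ) :
    C.step u n = (1 - (C.birth n + C.death n) / C.bound) * u n
      + C.birth n / C.bound * u (n + 1) + C.death n / C.bound * u (n - 1) := by
  rw [step_apply, gen]
  ring

theorem monotone_step : Monotone C.step := by
  intro u v huv n
  have hstay : 0 ≤ 1 - (C.birth n + C.death n) / C.bound :=
    sub_nonneg.2 ((div_le_one C.bound_pos).2 (C.birth_add_death_le n))
  have hbirth := div_nonneg (C.birth_pos n).le C.bound_pos.le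
  have hdeath := div_nonneg (C.death_nonneg n) C.bound_pos.le
  simp only [step_apply_eq_convex_combination]
  gcongr <;> exact huv _

theorem isFixedPt_step_const (b : ℝ) : Function.IsFixedPt C.step fun _ => b := by
  funext n
  simp [step_apply, gen]

theorem iterate_step_le {u : ℕ → ℝ} {b : ℝ} (hu : ∀ n, u n ≤ b) (r i : ℕ) :
    C.step^[r] u i ≤ b := by
  have h := C.monotone_step.iterate r (show u ≤ fun _ => b from hu) i
  rwa [(C.isFixedPt_step_const b).iterate r] at h

theorem le_iterate_step {u : ℕ → ℝ} {b : ℝ} (hu : ∀ n, b ≤ u n) (r i : ℕ) :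
    b ≤ C.step^[r] u i := by
  have h := C.monotone_step.iterate r (show (fun _ => b) ≤ u from hu) i
  rwa [(C.isFixedPt_step_const b).iterate r] at h

theorem abs_iterate_step_le {u : ℕ → ℝ} {D : ℝ} (hu : ∀ n, |u n| ≤ D) (r i : ℕ) :
    |C.step^[r] u i| ≤ D :=
  abs_le.2 ⟨C.le_iterate_step (fun n => (abs_le.1 (hu n)).1) r i,
    C.iterate_step_le (fun n => (abs_le.1 (hu n)).2) r i⟩

theorem iterate_step_smul (b : ℝ) (u : ℕ → ℝ) (r : ℕ) : C.step^[r] (b • u) = b • C.step^[r] u := by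
  simp only [← Module.End.pow_apply, map_smul]

theorem hasSum_iterate_step_single (r i : ℕ) :
    HasSum (fun j => C.step^[r] (Pi.single j 1) i) 1 := by
  induction r generalizing i with
  | zero =>
    simpa using hasSum_single (f := fun j => (Pi.single j 1 : ℕ → ℝ) i) i
      fun j hj => by simp [hj.symm]
  | succ r ih =>
    simp only [Function.iterate_succ_apply', step_apply_eq_convex_combination]
    have hmass : (1 - (C.birth i + C.death i) / C.bound) * 1 + C.birth i / C.bound * 1
        + C.death i / C.bound * 1 = 1 := by ring
    have h := (((ih i).mul_left (1 - (C.birth i + C.death i) / C.bound)).add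
      ((ih (i + 1)).mul_left (C.birth i / C.bound))).add
      ((ih (i - 1)).mul_left (C.death i / C.bound))
    rwa [hmass] at h

/-- The transition semigroup `exp (t B)` of the chain acting on functions, with `B` the generator:
the value `E [u (n_t) | n_0 = i]`. -/
def semigroup (t : ℝ) (u : ℕ → ℝ) (i : ℕ) : ℝ :=
  poissonMean (fun r => C.step^[r] u i) (C.bound * t)

theorem semigroup_smul (t b : ℝ) (u : ℕ → ℝ) (i : ℕ) :
    C.semigroup t (b • u) i = b * C.semigroup t u i := by
  simp only [semigroup, iterate_step_smul, Pi.smul_apply, smul_eq_mul, poissonMean_const_mul]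

section Bounded

variable {u v : ℕ → ℝ} {D E : ℝ}

theorem semigroup_sub (t : ℝ) (hu : ∀ n, |u n| ≤ D) (hv : ∀ n, |v n| ≤ E) (i : ℕ) :
    C.semigroup t (u - v) i = C.semigroup t u i - C.semigroup t v i := by
  simp only [semigroup, iterate_map_sub, Pi.sub_apply]
  exact poissonMean_sub (C.abs_iterate_step_le hu · i) (C.abs_iterate_step_le hv · i) _

theorem semigroup_nonneg {t : ℝ} (ht : 0 ≤ t) (hu : ∀ n, 0 ≤ u n) (i : ℕ) :
    0 ≤ C.semigroup t u i :=
  tsum_nonneg fun r => mul_nonneg (poissonWeight_nonneg (mul_nonneg C.bound_pos.le ht) r)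
    (C.le_iterate_step hu r i)

theorem semigroup_le {t b : ℝ} (ht : 0 ≤ t) (hu : ∀ n, |u n| ≤ D) (hb : ∀ n, u n ≤ b) (i : ℕ) :
    C.semigroup t u i ≤ b := by
  have h := poissonMean_mono (C.abs_iterate_step_le hu · i) (fun _ => le_rfl)
    (mul_nonneg C.bound_pos.le ht) (C.iterate_step_le hb · i)
  rwa [poissonMean_const] at h

theorem hasDerivAt_semigroup (hu : ∀ n, |u n| ≤ D) (t : ℝ) (i : ℕ) :
    HasDerivAt (fun s => C.semigroup s u i) (C.semigroup t (C.gen u) i) t := by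
  have hgen : C.gen u = C.bound • (C.step u - u) := by
    funext n
    simp only [step_apply, Pi.smul_apply, Pi.sub_apply, smul_eq_mul, add_sub_cancel_left]
    exact (mul_div_cancel₀ _ C.bound_pos.ne').symm
  have hstep : ∀ n, |C.step u n| ≤ D := C.abs_iterate_step_le hu 1
  have hiter := C.abs_iterate_step_le hu
  have hclock : HasDerivAt (fun s : ℝ => C.bound * s) C.bound t := by
    simpa using (hasDerivAt_id t).const_mul C.bound
  rw [hgen, semigroup_smul, semigroup_sub C t hstep hu]
  exact ((hasDerivAt_poissonMean (hiter · i) _).comp t hclock).congr_deriv (mul_comm _ _)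

end Bounded

/-- The transition probability `P (n_t = j | n_0 = i)`. -/
def transProb (t : ℝ) (i j : ℕ) : ℝ := C.semigroup t (Pi.single j 1) i

theorem pi_single_one_mem_Icc (j n : ℕ) : (Pi.single j 1 : ℕ → ℝ) n ∈ Set.Icc 0 1 := by
  rcases eq_or_ne n j with rfl | h <;> simp [*]

theorem abs_pi_single_one_le (j n : ℕ) : |(Pi.single j 1 : ℕ → ℝ) n| ≤ 1 := by
  obtain ⟨h0, h1⟩ := pi_single_one_mem_Icc j n
  rwa [abs_of_nonneg h0]

theorem transProb_nonneg {t : ℝ} (ht : 0 ≤ t) (i j : ℕ) : 0 ≤ C.transProb t i j :=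
  C.semigroup_nonneg ht (fun n => (pi_single_one_mem_Icc j n).1) i

theorem transProb_le_one {t : ℝ} (ht : 0 ≤ t) (i j : ℕ) : C.transProb t i j ≤ 1 :=
  C.semigroup_le ht (abs_pi_single_one_le j) (fun n => (pi_single_one_mem_Icc j n).2) i

theorem continuous_transProb (i j : ℕ) : Continuous fun t => C.transProb t i j :=
  continuous_iff_continuousAt.2 fun t =>
    (C.hasDerivAt_semigroup (abs_pi_single_one_le j) t i).continuousAt

theorem hasSum_transProb {t : ℝ} (ht : 0 ≤ t) (i : ℕ) : HasSum (C.transProb t i) 1 := by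
  have hx : 0 ≤ C.bound * t := mul_nonneg C.bound_pos.le ht
  have hstep (r : ℕ) := C.hasSum_iterate_step_single r i
  have hnonneg (r j : ℕ) : 0 ≤ C.step^[r] (Pi.single j 1) i :=
    C.le_iterate_step (fun n => (pi_single_one_mem_Icc j n).1) r i
  have hlim := tendsto_tsum_of_dominated_convergence (𝓕 := atTop)
    (f := fun (s : Finset ℕ) (r : ℕ) => Real.exp (-(C.bound * t)) * (C.bound * t) ^ r /
      (r.factorial : ℝ) * ∑ j ∈ s, C.step^[r] (Pi.single j 1) i)
    (hasSum_poissonWeight (C.bound * t)).summable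
    (fun r => (hstep r).const_mul _) (.of_forall fun s r => ?_)
  · simp only [mul_one, (hasSum_poissonWeight _).tsum_eq, Finset.mul_sum] at hlim
    refine hlim.congr fun s => ?_
    exact Summable.tsum_finsetSum fun j _ => summable_poissonWeight_mul
      (C.abs_iterate_step_le (abs_pi_single_one_le j) · i) _
  · rw [Real.norm_of_nonneg (mul_nonneg (poissonWeight_nonneg hx r)
      (Finset.sum_nonneg fun j _ => hnonneg r j))]
    exact mul_le_of_le_one_right (poissonWeight_nonneg hx r)
      (sum_le_hasSum s (fun j _ => hnonneg r j) (hstep r))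

/-- A nonnegative, possibly vanishing, measure `w` on `ℕ` in detailed balance with the chain. -/
structure IsReversing (w : ℕ → ℝ) : Prop where
  nonneg : ∀ n, 0 ≤ w n
  balance : ∀ n, C.birth n * w n = C.death (n + 1) * w (n + 1)

variable {C} {w : ℕ → ℝ}

namespace IsReversing

theorem pos_of_pos (hw : C.IsReversing w) {n : ℕ} (hn : 0 < w n) :
    0 < C.death (n + 1) ∧ 0 < w (n + 1) := by
  have h : 0 < C.death (n + 1) * w (n + 1) := hw.balance n ▸ mul_pos (C.birth_pos n) hn
  exact ⟨pos_of_mul_pos_left h (hw.nonneg _), pos_of_mul_pos_right h (C.death_nonneg _)⟩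

theorem pos_of_le (hw : C.IsReversing w) {m n : ℕ} (hmn : m ≤ n) (hm : 0 < w m) : 0 < w n :=
  Nat.le_induction hm (fun _ _ h => (hw.pos_of_pos h).2) n hmn

theorem hasSum_mul_gen (hw : C.IsReversing w) {u : ℕ → ℝ} (hu : Summable fun n => w n * u n) :
    HasSum (fun n => w n * C.gen u n) 0 := by
  have hsummable {a : ℕ → ℝ} (h0 : ∀ n, 0 ≤ a n) (ha : ∀ n, a n ≤ C.bound) :
      Summable fun n => a n * (w n * u n) :=
    (hu.norm.mul_left C.bound).of_norm_bounded fun n => by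
      rw [norm_mul, Real.norm_of_nonneg (h0 n)]
      exact mul_le_mul_of_nonneg_right (ha n) (norm_nonneg _)
  have hbirth := (hsummable (fun n => (C.birth_pos n).le) C.birth_le).hasSum
  have hdeath := (hsummable C.death_nonneg C.death_le).hasSum
  have hup : HasSum (fun n => C.birth n * w n * u (n + 1))
      (∑' n, C.death n * (w n * u n)) := by
    have h := (hasSum_nat_add_iff' 1).2 hdeath
    simp only [Finset.range_one, Finset.sum_singleton, C.death_zero, zero_mul, sub_zero] at h
    exact h.congr_fun fun n => by rw [hw.balance, mul_assoc]
  have hdown : HasSum (fun n => C.death n * w n * u (n - 1))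
      (∑' n, C.birth n * (w n * u n)) := by
    refine (hasSum_nat_add_iff' 1).1 ?_
    simp only [Finset.range_one, Finset.sum_singleton, C.death_zero, zero_mul, sub_zero]
    exact hbirth.congr_fun fun n => by rw [← hw.balance, Nat.add_sub_cancel, mul_assoc]
  have h := (hup.sub hbirth).add (hdown.sub hdeath)
  rw [sub_add_sub_cancel, sub_self] at h
  refine h.congr_fun fun n => ?_
  rw [gen]
  ring

theorem mul_iterate_step_single_le (hw : C.IsReversing w) (r i j : ℕ) :
    w i * C.step^[r] (Pi.single j 1) i ≤ w j := by
  have hsum : HasSum (fun n => w n * C.step^[r] (Pi.single j 1) n) (w j) := by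
    induction r with
    | zero =>
      simpa using hasSum_single (f := fun n => w n * (Pi.single j 1 : ℕ → ℝ) n) j
        fun n hn => by simp [hn]
    | succ r ih =>
      have h := ih.add ((hw.hasSum_mul_gen ih.summable).mul_right C.bound⁻¹)
      rw [zero_mul, add_zero] at h
      refine h.congr_fun fun n => ?_
      rw [Function.iterate_succ_apply', step_apply]
      ring
  exact le_hasSum hsum i fun n _ => mul_nonneg (hw.nonneg n)
    (C.le_iterate_step (fun n => (pi_single_one_mem_Icc j n).1) r n)

theorem transProb_le (hw : C.IsReversing w) {t : ℝ} (ht : 0 ≤ t) {i : ℕ} (hi : 0 < w i) (j : ℕ) :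
    C.transProb t i j ≤ w j / w i := by
  have h := poissonMean_mono
    (C.abs_iterate_step_le (abs_pi_single_one_le j) · i) (fun _ => le_rfl)
    (mul_nonneg C.bound_pos.le ht)
    (fun r => (le_div_iff₀' hi).2 (hw.mul_iterate_step_single_le r i j))
  rwa [poissonMean_const] at h

end IsReversing

end BirthDeathChain

/-! ### Occupation times and the ergodic theorem -/

/-- The average of `φ` over the time interval `[0, T]`. -/
def timeAverage (φ : ℝ → ℝ) (T : ℝ) : ℝ := 1 / T * ∫ t in (0 : ℝ)..T, φ t

theorem timeAverage_mono {φ ψ : ℝ → ℝ} {T : ℝ} (hT : 0 < T)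
    (hφ : IntervalIntegrable φ MeasureTheory.volume 0 T)
    (hψ : IntervalIntegrable ψ MeasureTheory.volume 0 T) (h : ∀ t, 0 ≤ t → φ t ≤ ψ t) :
    timeAverage φ T ≤ timeAverage ψ T :=
  mul_le_mul_of_nonneg_left
    (intervalIntegral.integral_mono_on hT.le hφ hψ fun t ht => h t ht.1) (by positivity)

theorem timeAverage_congr {φ ψ : ℝ → ℝ} {T : ℝ} (hT : 0 < T) (h : ∀ t, 0 ≤ t → φ t = ψ t) :
    timeAverage φ T = timeAverage ψ T := by
  rw [timeAverage, timeAverage, intervalIntegral.integral_congr fun t ht =>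
    h t (Set.uIcc_of_le hT.le ▸ ht).1]

theorem timeAverage_const {T : ℝ} (hT : 0 < T) (b : ℝ) : timeAverage (fun _ => b) T = b := by
  rw [timeAverage, intervalIntegral.integral_const, smul_eq_mul, sub_zero, ← mul_assoc,
    one_div_mul_cancel hT.ne', one_mul]

namespace BirthDeathChain

variable (C : BirthDeathChain)

/-- The expected fraction of the time interval `[0, T]` that the chain started in `i` spends
in `j`. -/
def occ (T : ℝ) (i j : ℕ) : ℝ := timeAverage (fun t => C.transProb t i j) T

theorem occ_nonneg {T : ℝ} (hT : 0 < T) (i j : ℕ) : 0 ≤ C.occ T i j :=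
  mul_nonneg (by positivity)
    (intervalIntegral.integral_nonneg hT.le fun _ ht => C.transProb_nonneg ht.1 i j)

theorem occ_le {T b : ℝ} (hT : 0 < T) {i j : ℕ} (h : ∀ t, 0 ≤ t → C.transProb t i j ≤ b) :
    C.occ T i j ≤ b :=
  (timeAverage_mono hT ((C.continuous_transProb i j).intervalIntegrable 0 T)
    intervalIntegrable_const h).trans_eq (timeAverage_const hT b)

theorem occ_le_one {T : ℝ} (hT : 0 < T) (i j : ℕ) : C.occ T i j ≤ 1 :=
  C.occ_le hT fun _ ht => C.transProb_le_one ht i j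

theorem gen_indicator_Iic (n : ℕ) :
    C.gen ((Set.Iic n).indicator 1) =
      C.death (n + 1) • Pi.single (n + 1) 1 - C.birth n • Pi.single n 1 := by
  funext j
  simp only [gen, Set.indicator_apply, Set.mem_Iic, Pi.one_apply, Pi.sub_apply, Pi.smul_apply,
    Pi.single_apply, smul_eq_mul]
  grind

theorem hasDerivAt_semigroup_indicator_Iic (t : ℝ) (i n : ℕ) :
    HasDerivAt (fun s => C.semigroup s ((Set.Iic n).indicator 1) i)
      (C.death (n + 1) * C.transProb t i (n + 1) - C.birth n * C.transProb t i n) t := by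
  have hsingle (b : ℝ) (j m : ℕ) : |(b • (Pi.single j 1 : ℕ → ℝ)) m| ≤ |b| := by
    rw [Pi.smul_apply, smul_eq_mul, abs_mul]
    exact mul_le_of_le_one_right (abs_nonneg b) (abs_pi_single_one_le j m)
  have h := C.hasDerivAt_semigroup (u := (Set.Iic n).indicator 1) (D := 1)
    (fun m => by by_cases h : m ≤ n <;> simp [h]) t i
  rwa [gen_indicator_Iic, C.semigroup_sub t (hsingle _ _) (hsingle _ _), semigroup_smul,
    semigroup_smul] at h

theorem abs_flow_le {T : ℝ} (hT : 0 < T) (i n : ℕ) :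
    |C.death (n + 1) * C.occ T i (n + 1) - C.birth n * C.occ T i n| ≤ 1 / T := by
  have hint (j : ℕ) : IntervalIntegrable (fun t => C.transProb t i j) MeasureTheory.volume 0 T :=
    (C.continuous_transProb i j).intervalIntegrable 0 T
  have hftc := intervalIntegral.integral_eq_sub_of_hasDerivAt
    (fun t _ => C.hasDerivAt_semigroup_indicator_Iic t i n)
    (((hint (n + 1)).const_mul _).sub ((hint n).const_mul _))
  rw [intervalIntegral.integral_sub ((hint _).const_mul _) ((hint _).const_mul _),
    intervalIntegral.integral_const_mul, intervalIntegral.integral_const_mul] at hftc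
  have hmem {t : ℝ} (ht : 0 ≤ t) : C.semigroup t ((Set.Iic n).indicator 1) i ∈ Set.Icc 0 1 :=
    ⟨C.semigroup_nonneg ht (fun m => by by_cases h : m ≤ n <;> simp [h]) i,
      C.semigroup_le (D := 1) ht (fun m => by by_cases h : m ≤ n <;> simp [h])
        (fun m => by by_cases h : m ≤ n <;> simp [h]) i⟩
  rw [occ, occ, timeAverage, timeAverage, mul_left_comm, mul_left_comm (C.birth n), ← mul_sub,
    hftc, abs_mul, abs_of_pos (by positivity : 0 < 1 / T)]
  refine mul_le_of_le_one_right (by positivity) ?_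
  exact Real.dist_le_of_mem_Icc_01 (hmem hT.le) (hmem le_rfl)

theorem tendsto_flow (i n : ℕ) :
    Tendsto (fun T => C.death (n + 1) * C.occ T i (n + 1) - C.birth n * C.occ T i n) atTop
      (𝓝 0) :=
  squeeze_zero_norm' ((eventually_gt_atTop 0).mono fun _ hT => C.abs_flow_le hT i n)
    (tendsto_const_nhds.div_atTop tendsto_id)

/-- The expectation `E [f (n_t) | n_0 = i]` of a possibly unbounded function. -/
def expect (t : ℝ) (f : ℕ → ℝ) (i : ℕ) : ℝ := ∑' j, C.transProb t i j * f j

/-- The time averages of the (finite) expectations of `f (n_t)`, started in `i`, tend to `η`. -/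
structure HasTimeAverage (f : ℕ → ℝ) (i : ℕ) (η : ℝ) : Prop where
  summable : ∀ t, 0 ≤ t → Summable fun j => C.transProb t i j * f j
  intervalIntegrable : ∀ T, 0 ≤ T →
    IntervalIntegrable (fun t => C.expect t f i) MeasureTheory.volume 0 T
  tendsto : Tendsto (timeAverage fun t => C.expect t f i) atTop (𝓝 η)

/-- A finite nonzero reversing measure; its normalization is a stationary distribution. -/
structure IsStationary (w : ℕ → ℝ) : Prop extends C.IsReversing w where
  summable : Summable w
  exists_pos : ∃ i, 0 < w i

/-- The mean of `f` under the probability measure proportional to `w`. -/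
def mean (w f : ℕ → ℝ) : ℝ := (∑' n, w n * f n) / ∑' n, w n

variable {C} {w f : ℕ → ℝ} {i : ℕ}

theorem IsStationary.tsum_pos (hw : C.IsStationary w) : 0 < ∑' n, w n :=
  let ⟨_, hi⟩ := hw.exists_pos
  hw.summable.tsum_pos hw.nonneg _ hi

theorem IsReversing.tendsto_mul_occ_sub (hw : C.IsReversing w) (i : ℕ) {k : ℕ} (hk : 0 < w k)
    (n : ℕ) : Tendsto (fun T => w k * C.occ T i n - w n * C.occ T i k) atTop (𝓝 0) := by
  have hflow (n : ℕ) : Tendsto (fun T => C.death (n + 1) *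
      (w k * C.occ T i (n + 1) - w (n + 1) * C.occ T i k)
        - C.birth n * (w k * C.occ T i n - w n * C.occ T i k)) atTop (𝓝 0) := by
    rw [← mul_zero (w k)]
    refine ((C.tendsto_flow i n).const_mul (w k)).congr fun T => ?_
    linear_combination -C.occ T i k * hw.balance n
  rcases le_total k n with hkn | hnk
  · induction n, hkn using Nat.le_induction with
    | base => simp
    | succ n hkn ih =>
      have hdeath := (hw.pos_of_pos (hw.pos_of_le hkn hk)).1
      have h := ((hflow n).add (ih.const_mul (C.birth n))).const_mul (C.death (n + 1))⁻¹
      rw [mul_zero, add_zero, mul_zero] at h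
      exact h.congr fun T => by rw [sub_add_cancel, inv_mul_cancel_left₀ hdeath.ne']
  · induction hnk using Nat.decreasingInduction with
    | self => simp
    | of_succ n _ ih =>
      have h := ((ih.const_mul (C.death (n + 1))).sub (hflow n)).const_mul (C.birth n)⁻¹
      rw [mul_zero, sub_zero, mul_zero] at h
      exact h.congr fun T => by rw [sub_sub_cancel, inv_mul_cancel_left₀ (C.birth_pos n).ne']

section Dominated

theorem IsReversing.norm_transProb_mul_le (hw : C.IsReversing w) (hi : 0 < w i) {t : ℝ}
    (ht : 0 ≤ t) (j : ℕ) : ‖C.transProb t i j * f j‖ ≤ ‖w j * f j‖ / w i := by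
  rw [norm_mul, norm_mul, Real.norm_of_nonneg (C.transProb_nonneg ht i j),
    Real.norm_of_nonneg (hw.nonneg j), mul_div_right_comm]
  exact mul_le_mul_of_nonneg_right (hw.transProb_le ht hi j) (norm_nonneg _)

theorem IsReversing.norm_occ_mul_le (hw : C.IsReversing w) (hi : 0 < w i) {T : ℝ}
    (hT : 0 < T) (j : ℕ) : ‖C.occ T i j * f j‖ ≤ ‖w j * f j‖ / w i := by
  rw [norm_mul, norm_mul, Real.norm_of_nonneg (C.occ_nonneg hT i j),
    Real.norm_of_nonneg (hw.nonneg j), mul_div_right_comm]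
  exact mul_le_mul_of_nonneg_right (C.occ_le hT fun t ht => hw.transProb_le ht hi j)
    (norm_nonneg _)

variable (hw : C.IsReversing w) (hf : Summable fun n => w n * f n) (hi : 0 < w i)
include hw hf hi

theorem IsReversing.summable_transProb_mul {t : ℝ} (ht : 0 ≤ t) :
    Summable fun j => C.transProb t i j * f j :=
  (hf.norm.div_const (w i)).of_norm_bounded fun j => hw.norm_transProb_mul_le hi ht j

theorem IsReversing.intervalIntegrable_expect {T : ℝ} (hT : 0 ≤ T) :
    IntervalIntegrable (fun t => C.expect t f i) MeasureTheory.volume 0 T := by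
  refine ContinuousOn.intervalIntegrable_of_Icc hT ?_
  exact continuousOn_tsum
    (fun j => ((C.continuous_transProb i j).mul continuous_const).continuousOn)
    (hf.norm.div_const (w i)) fun j t ht => hw.norm_transProb_mul_le hi ht.1 j

theorem IsReversing.hasSum_occ_mul {T : ℝ} (hT : 0 < T) :
    HasSum (fun j => C.occ T i j * f j) (timeAverage (fun t => C.expect t f i) T) := by
  have hpos {t : ℝ} (ht : t ∈ Set.uIoc 0 T) : 0 ≤ t := (Set.uIoc_of_le hT.le ▸ ht).1.le
  have h := intervalIntegral.hasSum_integral_of_dominated_convergence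
    (μ := MeasureTheory.volume) (a := 0) (b := T) (F := fun j t => C.transProb t i j * f j)
    (fun j _ => ‖w j * f j‖ / w i)
    (fun j => ((C.continuous_transProb i j).mul continuous_const).aestronglyMeasurable)
    (fun j => .of_forall fun t ht => hw.norm_transProb_mul_le hi (hpos ht) j)
    (.of_forall fun _ _ => hf.norm.div_const (w i)) intervalIntegrable_const
    (.of_forall fun t ht => (hw.summable_transProb_mul hf hi (hpos ht)).hasSum)
  refine (h.mul_left (1 / T)).congr_fun fun j => ?_
  rw [intervalIntegral.integral_mul_const, ← mul_assoc]
  rfl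

end Dominated

theorem IsStationary.hasSum_occ (hw : C.IsStationary w) (hi : 0 < w i) {T : ℝ} (hT : 0 < T) :
    HasSum (C.occ T i) 1 := by
  have h := hw.hasSum_occ_mul (f := fun _ => 1) (by simpa using hw.summable) hi hT
  have hexpect : timeAverage (fun t => C.expect t (fun _ => 1) i) T = 1 := by
    rw [timeAverage_congr hT (ψ := fun _ => 1), timeAverage_const hT]
    intro t ht
    simp only [expect, mul_one, (C.hasSum_transProb ht i).tsum_eq]
  simpa only [mul_one, hexpect] using h

theorem IsStationary.tendsto_occ (hw : C.IsStationary w) (hi : 0 < w i) (j : ℕ) :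
    Tendsto (fun T => C.occ T i j) atTop (𝓝 (w j / ∑' n, w n)) := by
  have hself : Tendsto (fun T => C.occ T i i) atTop (𝓝 (w i / ∑' n, w n)) := by
    have hbound : ∀ᶠ T in atTop, ∀ n, ‖w i * C.occ T i n - w n * C.occ T i i‖ ≤ w n := by
      filter_upwards [eventually_gt_atTop 0] with T hT n
      refine abs_sub_le_of_nonneg_of_le (mul_nonneg hi.le (C.occ_nonneg hT i n)) ?_
        (mul_nonneg (hw.nonneg n) (C.occ_nonneg hT i i))
        (mul_le_of_le_one_right (hw.nonneg n) (C.occ_le_one hT i i))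
      exact (le_div_iff₀' hi).1 (C.occ_le hT fun t ht => hw.transProb_le ht hi n)
    have h := tendsto_tsum_of_dominated_convergence hw.summable
      (hw.tendsto_mul_occ_sub i hi) hbound
    rw [tsum_zero] at h
    have hlim := (h.const_sub (w i)).div_const (∑' n, w n)
    rw [sub_zero] at hlim
    refine hlim.congr' ((eventually_gt_atTop 0).mono fun T hT => ?_)
    have hocc := hw.hasSum_occ hi hT
    rw [(hocc.summable.mul_left _).tsum_sub (hw.summable.mul_right _), tsum_mul_left,
      tsum_mul_right, hocc.tsum_eq, mul_one, sub_sub_cancel, mul_div_cancel_left₀ _ hw.tsum_pos.ne']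
  have h := ((hw.tendsto_mul_occ_sub i hi j).add (hself.const_mul (w j))).div_const (w i)
  rw [zero_add, mul_div_left_comm, mul_div_cancel_left₀ _ hi.ne'] at h
  exact h.congr fun T => by rw [sub_add_cancel, mul_div_cancel_left₀ _ hi.ne']

theorem IsStationary.hasTimeAverage (hw : C.IsStationary w) (hf : Summable fun n => w n * f n)
    (hi : 0 < w i) : C.HasTimeAverage f i (mean w f) where
  summable _ ht := hw.summable_transProb_mul hf hi ht
  intervalIntegrable _ hT := hw.intervalIntegrable_expect hf hi hT
  tendsto := by
    have h := tendsto_tsum_of_dominated_convergence (hf.norm.div_const (w i))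
      (fun j => (hw.tendsto_occ hi j).mul_const (f j))
      ((eventually_gt_atTop 0).mono fun T hT j => hw.norm_occ_mul_le hi hT j)
    simp only [div_mul_eq_mul_div, tsum_div_const] at h
    exact h.congr' ((eventually_gt_atTop 0).mono fun T hT =>
      (hw.hasSum_occ_mul hf hi hT).tsum_eq)

theorem HasTimeAverage.add_sum_occ_mul_le {η : ℝ} (h : C.HasTimeAverage f i η) {T : ℝ}
    (hT : 0 < T) {s : Finset ℕ} {b : ℝ} (hb : ∀ j ∉ s, b ≤ f j) :
    b + ∑ j ∈ s, C.occ T i j * (f j - b) ≤ timeAverage (fun t => C.expect t f i) T := by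
  have hcont (j : ℕ) : Continuous fun t => C.transProb t i j * (f j - b) :=
    (C.continuous_transProb i j).mul continuous_const
  have hsum : Continuous fun t => ∑ j ∈ s, C.transProb t i j * (f j - b) :=
    continuous_finsetSum s fun j _ => hcont j
  have hle (t : ℝ) (ht : 0 ≤ t) :
      b + ∑ j ∈ s, C.transProb t i j * (f j - b) ≤ C.expect t f i := by
    have hmass := (C.hasSum_transProb ht i).mul_right b
    have hexcess : HasSum (fun j => C.transProb t i j * (f j - b)) (C.expect t f i - b) := by
      have hdiff := (h.summable t ht).hasSum.sub hmass
      rw [one_mul] at hdiff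
      exact hdiff.congr_fun fun j => mul_sub _ _ _
    exact le_sub_iff_add_le'.1 (sum_le_hasSum s (fun j hj =>
      mul_nonneg (C.transProb_nonneg ht i j) (sub_nonneg.2 (hb j hj))) hexcess)
  have haverage : timeAverage (fun t => b + ∑ j ∈ s, C.transProb t i j * (f j - b)) T =
      b + ∑ j ∈ s, C.occ T i j * (f j - b) := by
    rw [timeAverage, intervalIntegral.integral_add intervalIntegrable_const
      (hsum.intervalIntegrable 0 T), mul_add, ← timeAverage, timeAverage_const hT,
      intervalIntegral.integral_finsetSum fun j _ => (hcont j).intervalIntegrable 0 T,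
      Finset.mul_sum]
    simp only [intervalIntegral.integral_mul_const, ← mul_assoc]
    rfl
  exact haverage.symm.trans_le (timeAverage_mono hT
    ((continuous_const.add hsum).intervalIntegrable 0 T) (h.intervalIntegrable T hT.le) hle)

variable (C) in
theorem exists_tendsto_occ (U : Ultrafilter ℝ) (hU : ↑U ≤ (atTop : Filter ℝ)) (i j : ℕ) :
    ∃ w, Tendsto (fun T => C.occ T i j) U (𝓝 w) := by
  have hmem : ∀ᶠ T in (U : Filter ℝ), C.occ T i j ∈ Set.Icc 0 1 :=
    hU ((eventually_gt_atTop 0).mono fun T hT => ⟨C.occ_nonneg hT i j, C.occ_le_one hT i j⟩)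
  obtain ⟨w, -, hw⟩ := isCompact_Icc.ultrafilter_le_nhds (U.map fun T => C.occ T i j)
    (le_principal_iff.2 hmem)
  exact ⟨w, hw⟩

theorem isReversing_of_tendsto_occ {U : Filter ℝ} [U.NeBot] (hU : U ≤ atTop)
    (hw : ∀ j, Tendsto (fun T => C.occ T i j) U (𝓝 (w j))) : C.IsReversing w where
  nonneg j := ge_of_tendsto (hw j)
    (hU ((eventually_gt_atTop 0).mono fun _ hT => C.occ_nonneg hT i j))
  balance n := (sub_eq_zero.1 (tendsto_nhds_unique
    (((hw (n + 1)).const_mul _).sub ((hw n).const_mul _))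
    ((C.tendsto_flow i n).mono_left hU))).symm

theorem isStationary_of_add_sum_le {η : ℝ} (hw : C.IsReversing w) (hf : Tendsto f atTop atTop)
    (h : ∀ (s : Finset ℕ) (b : ℝ), (∀ j ∉ s, b ≤ f j) → b + ∑ j ∈ s, w j * (f j - b) ≤ η) :
    C.IsStationary w ∧ Summable fun n => w n * f n := by
  obtain ⟨m, hm⟩ : BddBelow (Set.range f) :=
    bddBelow_range_of_tendsto_atTop_atTop hf
  have hle (j : ℕ) : m ≤ f j := hm (Set.mem_range_self j)
  have hexcess : Summable fun j => w j * (f j - (m - 1)) :=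
    summable_of_sum_le (fun j => mul_nonneg (hw.nonneg j) (by linarith [hle j])) fun s =>
      le_sub_iff_add_le'.2 (h s (m - 1) fun j _ => by linarith [hle j])
  have hsummable : Summable w := hexcess.of_nonneg_of_le hw.nonneg fun j =>
    le_mul_of_one_le_right (hw.nonneg j) (by linarith [hle j])
  refine ⟨⟨hw, hsummable, ?_⟩,
    (hexcess.add (hsummable.mul_right (m - 1))).congr fun j => by ring⟩
  by_contra! hzero
  obtain ⟨N, hN⟩ := eventually_atTop.1 (hf.eventually_ge_atTop (η + 1))
  have hsum := h (Finset.range N) (η + 1) fun j hj => hN j (by simpa using hj)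
  rw [Finset.sum_eq_zero fun j _ => by rw [(hzero j).antisymm (hw.nonneg j), zero_mul]] at hsum
  linarith

/-- The limits of the occupation frequencies along an ultrafilter form a reversing measure. It does
not vanish, because mass that escapes to infinity would make the average of `f` infinite. -/
theorem HasTimeAverage.exists_isStationary {η : ℝ} (h : C.HasTimeAverage f i η)
    (hf : Tendsto f atTop atTop) : ∃ w, C.IsStationary w ∧ Summable fun n => w n * f n := by
  let U : Ultrafilter ℝ := .of atTop
  have hU : ↑U ≤ (atTop : Filter ℝ) := Ultrafilter.of_le atTop
  choose w hw using C.exists_tendsto_occ U hU i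
  refine ⟨w, isStationary_of_add_sum_le (η := η) (isReversing_of_tendsto_occ hU hw) hf
    fun s b hb => ?_⟩
  exact le_of_tendsto_of_tendsto
    ((tendsto_finsetSum s fun j _ => (hw j).mul_const _).const_add b) (h.tendsto.mono_left hU)
    (hU ((eventually_gt_atTop 0).mono fun T hT => h.add_sum_occ_mul_le hT hb))

/-! ### Policy improvement -/

section Improvement

variable {C' : BirthDeathChain} {w' f' G G' : ℕ → ℝ} {η : ℝ}

variable (C) in
/-- The residual `f - η 1 + B g` of the Poisson equation, in terms of the differences
`G n = g n - g (n - 1)` of the potential `g`. -/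
def residual (f : ℕ → ℝ) (η : ℝ) (G : ℕ → ℝ) (n : ℕ) : ℝ :=
  f n - η + C.birth n * G (n + 1) - C.death n * G n

theorem IsReversing.sum_mul_residual (hw : C.IsReversing w) (f : ℕ → ℝ) (η : ℝ) (G : ℕ → ℝ)
    (n : ℕ) : ∑ j ∈ Finset.range (n + 1), w j * C.residual f η G j =
      ∑ j ∈ Finset.range (n + 1), w j * (f j - η) + w n * (C.birth n * G (n + 1)) := by
  induction n with
  | zero =>
    simp only [zero_add, Finset.range_one, Finset.sum_singleton, residual, C.death_zero]
    ring
  | succ n ih =>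
    rw [Finset.sum_range_succ, ih, Finset.sum_range_succ _ (n + 1), residual]
    linear_combination G (n + 1) * hw.balance n

theorem IsStationary.hasSum_mul_sub (hw : C.IsStationary w) (hf : Summable fun n => w n * f n)
    (η : ℝ) : HasSum (fun n => w n * (f n - η)) ((∑' n, w n) * (mean w f - η)) := by
  rw [mul_sub, mean, mul_div_cancel₀ _ hw.tsum_pos.ne']
  exact (hf.hasSum.sub (hw.summable.hasSum.mul_right η)).congr_fun fun n => mul_sub _ _ _

theorem IsStationary.tendsto_flux (hw : C.IsStationary w) (hf : Summable fun n => w n * f n)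
    (hG : ∀ n, C.residual f (mean w f) G n = 0) :
    Tendsto (fun n => w n * (C.birth n * G (n + 1))) atTop (𝓝 0) := by
  have hsum := hw.hasSum_mul_sub hf (mean w f)
  rw [sub_self, mul_zero] at hsum
  have h := (hsum.tendsto_sum_nat.comp (tendsto_add_atTop_nat 1)).neg
  rw [neg_zero] at h
  refine h.congr fun n => neg_eq_of_add_eq_zero_right ?_
  rw [Function.comp_apply, ← hw.sum_mul_residual f (mean w f) G n]
  exact Finset.sum_eq_zero fun j _ => by rw [hG, mul_zero]

theorem IsStationary.eventually_nonneg_of_residual_eq_zero (hw : C.IsStationary w)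
    (hf : Summable fun n => w n * f n) (hf' : Tendsto f atTop atTop)
    (hG : ∀ n, C.residual f (mean w f) G n = 0) : ∀ᶠ n in atTop, 0 ≤ G n := by
  have hsum := hw.hasSum_mul_sub hf (mean w f)
  rw [sub_self, mul_zero] at hsum
  obtain ⟨i, hi⟩ := hw.exists_pos
  obtain ⟨m, hm⟩ := eventually_atTop.1 (hf'.eventually_ge_atTop (mean w f))
  suffices ∀ᶠ n in atTop, 0 ≤ G (n + 1) by
    obtain ⟨N, hN⟩ := eventually_atTop.1 this
    filter_upwards [eventually_gt_atTop N] with n hn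
    simpa [Nat.sub_add_cancel (Nat.one_le_of_lt hn)] using hN (n - 1) (Nat.le_sub_one_of_lt hn)
  filter_upwards [eventually_ge_atTop i, eventually_ge_atTop m] with n hin hmn
  have hpartial : ∑ j ∈ Finset.range (n + 1), w j * (f j - mean w f) ≤ 0 :=
    sum_le_hasSum _ (fun j hj => mul_nonneg (hw.nonneg j)
      (sub_nonneg.2 (hm j (by simp only [Finset.mem_range] at hj; omega)))) hsum
  have hflux := hw.sum_mul_residual f (mean w f) G n
  simp only [hG, mul_zero, Finset.sum_const_zero] at hflux
  have hnonneg : 0 ≤ w n * (C.birth n * G (n + 1)) := by linarith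
  exact nonneg_of_mul_nonneg_right (nonneg_of_mul_nonneg_right hnonneg (hw.pos_of_le hin hi))
    (C.birth_pos n)

theorem IsStationary.mean_lt (hw : C.IsStationary w) (hf : Summable fun n => w n * f n)
    (hflux : Tendsto (fun n => w n * (C.birth n * G (n + 1))) atTop (𝓝 0))
    (hG : ∀ n, C.residual f η G n ≤ 0) {m : ℕ} (hm : C.residual f η G m < 0) (hwm : 0 < w m) :
    mean w f < η := by
  have hlim := ((hw.hasSum_mul_sub hf η).tendsto_sum_nat.comp (tendsto_add_atTop_nat 1)).add hflux
  rw [add_zero] at hlim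
  have hle : (∑' n, w n) * (mean w f - η) ≤ w m * C.residual f η G m := by
    refine le_of_tendsto hlim ((eventually_ge_atTop m).mono fun n hn => ?_)
    rw [Function.comp_apply, ← hw.sum_mul_residual f η G n,
      ← Finset.add_sum_erase _ _ (Finset.mem_range.2 (Nat.lt_succ_of_le hn))]
    exact add_le_of_nonpos_right (Finset.sum_nonpos fun j _ =>
      mul_nonpos_of_nonneg_of_nonpos (hw.nonneg j) (hG j))
  exact sub_neg.1 (neg_of_mul_neg_right (hle.trans_lt (mul_neg_of_pos_of_neg hwm hm))
    hw.tsum_pos.le)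

theorem exists_isReversing (h : ∀ n, 0 < C.death (n + 1)) :
    ∃ w, C.IsReversing w ∧ ∀ n, 0 < w n := by
  have hpos (n : ℕ) : 0 < ∏ j ∈ Finset.range n, C.birth j / C.death (j + 1) :=
    Finset.prod_pos fun j _ => div_pos (C.birth_pos j) (h j)
  refine ⟨_, ⟨fun n => (hpos n).le, fun n => ?_⟩, hpos⟩
  rw [Finset.prod_range_succ, mul_left_comm, mul_div_cancel₀ _ (h n).ne', mul_comm]

theorem IsReversing.exists_eventuallyEq_mul (hw : C.IsReversing w) (hi : 0 < w i)
    (hw' : C'.IsReversing w') (hbirth : C'.birth =ᶠ[atTop] C.birth)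
    (hdeath : C'.death =ᶠ[atTop] C.death) : ∃ a, w' =ᶠ[atTop] fun n => a * w n := by
  obtain ⟨m, hm⟩ := eventually_atTop.1 (hbirth.and hdeath)
  have hpos {n : ℕ} (hn : max i m ≤ n) : 0 < w n := hw.pos_of_le (le_of_max_le_left hn) hi
  refine ⟨w' (max i m) / w (max i m), eventually_atTop.2 ⟨max i m, fun n hn => ?_⟩⟩
  induction n, hn using Nat.le_induction with
  | base => exact (div_mul_cancel₀ _ (hpos le_rfl).ne').symm
  | succ n hn ih =>
    have hmn := le_of_max_le_right hn
    have hbalance := hw'.balance n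
    rw [(hm n hmn).1, (hm (n + 1) (Nat.le_succ_of_le hmn)).2, ih] at hbalance
    refine mul_left_cancel₀ (hw.pos_of_pos (hpos hn)).1.ne' ?_
    linear_combination w' (max i m) / w (max i m) * hw.balance n - hbalance

theorem IsStationary.exists_lt_hasTimeAverage (hw : C.IsStationary w)
    (hf : Summable fun n => w n * f n) (hG : ∀ n, C.residual f (mean w f) G n = 0)
    (hbirth : C'.birth =ᶠ[atTop] C.birth) (hdeath : C'.death =ᶠ[atTop] C.death)
    (hff : f' =ᶠ[atTop] f) (hGG : G' =ᶠ[atTop] G) (hpos : ∀ n, 0 < C'.death (n + 1))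
    (hG' : ∀ n, C'.residual f' (mean w f) G' n ≤ 0) {m : ℕ}
    (hm : C'.residual f' (mean w f) G' m < 0) :
    ∃ η' < mean w f, ∀ i, C'.HasTimeAverage f' i η' := by
  obtain ⟨w', hw', hpos'⟩ := exists_isReversing hpos
  obtain ⟨i, hi⟩ := hw.exists_pos
  obtain ⟨a, ha⟩ := hw.exists_eventuallyEq_mul hi hw' hbirth hdeath
  have hstat : C'.IsStationary w' :=
    ⟨hw', (summable_congr_atTop ha).2 (hw.summable.mul_left a), 0, hpos' 0⟩
  have hf' : Summable fun n => w' n * f' n := by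
    refine (summable_congr_atTop ?_).2 (hf.mul_left a)
    filter_upwards [ha, hff] with n han hfn
    rw [han, hfn, mul_assoc]
  refine ⟨mean w' f', hstat.mean_lt hf' ?_ hG' hm (hpos' m), fun i =>
    hstat.hasTimeAverage hf' (hpos' i)⟩
  have hflux := (hw.tendsto_flux hf hG).const_mul a
  rw [mul_zero] at hflux
  refine hflux.congr' ?_
  filter_upwards [ha, hbirth, (tendsto_add_atTop_nat 1).eventually hGG] with n han hbn hGn
  rw [han, hbn, hGn, mul_assoc]

end Improvement

end BirthDeathChain

/-! ### The gain of an action -/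

namespace GroupServerQueue

variable {K : ℕ} (Q : GroupServerQueue K)

theorem rate_nonneg (m : Fin K → ℕ) : 0 ≤ Q.rate m :=
  Finset.sum_nonneg fun k _ => mul_nonneg (Nat.cast_nonneg _) (Q.mu_pos k).le

theorem rate_pos_iff {m : Fin K → ℕ} : 0 < Q.rate m ↔ m ≠ 0 := by
  rw [(Q.rate_nonneg m).lt_iff_ne', Ne, rate, Finset.sum_eq_zero_iff_of_nonneg fun k _ =>
    mul_nonneg (Nat.cast_nonneg _) (Q.mu_pos k).le]
  simp [funext_iff, (Q.mu_pos _).ne']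

/-- The actions that an efficient policy may take with `n` customers present. -/
def actions (n : ℕ) : Finset (Fin K → ℕ) := {m ∈ Finset.Iic Q.M | total m ≤ n}

/-- The net rate of gain from the action `m` when the departure of a customer is worth `x`. -/
def gain (x : ℝ) (m : Fin K → ℕ) : ℝ := ∑ k, (m k : ℝ) * (Q.mu k * x - Q.c k)

variable {Q} {n n' : ℕ} {x y : ℝ} {m p : Fin K → ℕ} {k : Fin K}

theorem total_add_single (m : Fin K → ℕ) (k : Fin K) : total (m + Pi.single k 1) = total m + 1 := by
  simp [total, Finset.sum_add_distrib]

theorem total_mono : Monotone (total : (Fin K → ℕ) → ℕ) := fun _ _ h =>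
  Finset.sum_le_sum fun k _ => h k

theorem exists_eq_add_single (h : m k ≠ 0) : ∃ p : Fin K → ℕ, m = p + Pi.single k 1 :=
  le_iff_exists_add'.1 (update_le_iff.2 ⟨Nat.one_le_iff_ne_zero.2 h, fun _ _ => Nat.zero_le _⟩)

theorem mem_actions : m ∈ Q.actions n ↔ m ≤ Q.M ∧ total m ≤ n := by
  rw [actions, Finset.mem_filter, Finset.mem_Iic]

theorem actions_mono (h : n ≤ n') : Q.actions n ⊆ Q.actions n' := fun _ hm =>
  mem_actions.2 ⟨(mem_actions.1 hm).1, (mem_actions.1 hm).2.trans h⟩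

theorem mem_actions_of_le (h : p ≤ m) (hm : m ∈ Q.actions n) : p ∈ Q.actions n :=
  mem_actions.2 ⟨h.trans (mem_actions.1 hm).1, (total_mono h).trans (mem_actions.1 hm).2⟩

theorem zero_mem_actions (n : ℕ) : 0 ∈ Q.actions n :=
  mem_actions.2 ⟨fun _ => Nat.zero_le _, by simp [total]⟩

theorem eq_zero_of_mem_actions_zero (hm : m ∈ Q.actions 0) : m = 0 := by
  have h := Nat.le_zero.1 (mem_actions.1 hm).2
  exact funext fun k => Finset.sum_eq_zero_iff.1 h k (Finset.mem_univ k)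

theorem add_single_mem_actions (hm : m ∈ Q.actions n) (hk : m k < Q.M k) :
    m + Pi.single k 1 ∈ Q.actions (n + 1) := by
  obtain ⟨hM, hn⟩ := mem_actions.1 hm
  refine mem_actions.2 ⟨fun j => ?_, by rw [total_add_single]; omega⟩
  rcases eq_or_ne j k with rfl | hj
  · simpa using hk
  · simpa [hj] using hM j

theorem mem_actions_of_add_single_mem (hm : m + Pi.single k 1 ∈ Q.actions (n + 1)) :
    m ∈ Q.actions n := by
  obtain ⟨hM, hn⟩ := mem_actions.1 hm
  rw [total_add_single] at hn
  exact mem_actions.2 ⟨le_self_add.trans hM, Nat.le_of_succ_le_succ hn⟩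

theorem single_mem_actions (hk : 0 < Q.M k) (n : ℕ) : Pi.single k 1 ∈ Q.actions (n + 1) := by
  simpa only [zero_add] using add_single_mem_actions (zero_mem_actions n) hk

theorem gain_zero (x : ℝ) : Q.gain x 0 = 0 := by simp [gain]

theorem gain_single (x : ℝ) (k : Fin K) : Q.gain x (Pi.single k 1) = Q.mu k * x - Q.c k := by
  rw [gain, Finset.sum_eq_single_of_mem k (Finset.mem_univ k) fun j _ hj => by simp [hj]]
  simp

theorem gain_add (x : ℝ) (m p : Fin K → ℕ) : Q.gain x (m + p) = Q.gain x m + Q.gain x p := by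
  simp only [gain, Pi.add_apply, Nat.cast_add, add_mul, Finset.sum_add_distrib]

theorem gain_mono (h : y ≤ x) (m : Fin K → ℕ) : Q.gain y m ≤ Q.gain x m :=
  Finset.sum_le_sum fun k _ => mul_le_mul_of_nonneg_left
    (sub_le_sub_right (mul_le_mul_of_nonneg_left h (Q.mu_pos k).le) _) (Nat.cast_nonneg _)

theorem gain_le_sum_abs (hm : m ≤ Q.M) (x : ℝ) :
    Q.gain x m ≤ ∑ k, (Q.M k : ℝ) * |Q.mu k * x - Q.c k| :=
  Finset.sum_le_sum fun k _ =>
    (mul_le_mul_of_nonneg_left (le_abs_self _) (Nat.cast_nonneg _)).trans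
      (mul_le_mul_of_nonneg_right (Nat.cast_le.2 (hm k)) (abs_nonneg _))

section Maximizer

variable (hmax : IsMaxOn (Q.gain x) (Q.actions n) m) (hm : m ∈ Q.actions n)
include hmax hm

theorem eq_zero_of_isMaxOn_gain (hk : x < Q.c k / Q.mu k) : m k = 0 := by
  by_contra hne
  obtain ⟨p, rfl⟩ := exists_eq_add_single hne
  have h : Q.gain x p ≤ Q.gain x (p + Pi.single k 1) := hmax (mem_actions_of_le le_self_add hm)
  rw [gain_add, gain_single] at h
  rw [lt_div_iff₀ (Q.mu_pos k)] at hk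
  linarith

theorem le_total_of_isMaxOn_gain : min n (∑ k with x > Q.c k / Q.mu k, Q.M k) ≤ total m := by
  by_contra! hlt
  obtain ⟨hn, hM⟩ := lt_min_iff.1 hlt
  have hle : ∑ k with x > Q.c k / Q.mu k, m k ≤ total m :=
    Finset.sum_le_sum_of_subset (Finset.filter_subset _ _)
  obtain ⟨k, hk, hkM⟩ := Finset.exists_lt_of_sum_lt (hle.trans_lt hM)
  have hkx := (div_lt_iff₀ (Q.mu_pos k)).1 (Finset.mem_filter.1 hk).2
  have hmem : m + Pi.single k 1 ∈ Q.actions n := actions_mono hn <|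
    add_single_mem_actions (mem_actions.2 ⟨(mem_actions.1 hm).1, le_rfl⟩) hkM
  have h : Q.gain x (m + Pi.single k 1) ≤ Q.gain x m := hmax hmem
  rw [gain_add, gain_single] at h
  linarith

end Maximizer

theorem total_le_of_eq_zero (hm : m ∈ Q.actions n) {P : Fin K → Prop} [DecidablePred P]
    (h : ∀ k, ¬ P k → m k = 0) : total m ≤ min n (∑ k with P k, Q.M k) := by
  obtain ⟨hM, hn⟩ := mem_actions.1 hm
  refine le_min hn ?_
  calc total m = ∑ k with P k, m k :=
        (Finset.sum_filter_of_ne fun k _ hk => not_imp_comm.1 (h k) hk).symm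
    _ ≤ ∑ k with P k, Q.M k := Finset.sum_le_sum fun k _ => hM k

variable (Q) in
/-- The largest gain with `n` customers present. -/
def maxGain (n : ℕ) (x : ℝ) : ℝ := (Q.actions n).sup' ⟨0, zero_mem_actions n⟩ (Q.gain x)

theorem gain_le_maxGain (hm : m ∈ Q.actions n) (x : ℝ) : Q.gain x m ≤ Q.maxGain n x :=
  Finset.le_sup' (Q.gain x) hm

variable (Q) in
theorem exists_gain_eq_maxGain (n : ℕ) (x : ℝ) : ∃ m ∈ Q.actions n, Q.gain x m = Q.maxGain n x :=
  let ⟨m, hm, h⟩ := Finset.exists_mem_eq_sup' ⟨0, zero_mem_actions n⟩ (Q.gain x)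
  ⟨m, hm, h.symm⟩

theorem gain_eq_maxGain (hmax : IsMaxOn (Q.gain x) (Q.actions n) m) (hm : m ∈ Q.actions n) :
    Q.gain x m = Q.maxGain n x :=
  (gain_le_maxGain hm x).antisymm (Finset.sup'_le _ _ fun _ hp => hmax hp)

theorem monotone_maxGain (n : ℕ) : Monotone (Q.maxGain n) := fun _ _ h =>
  Finset.sup'_mono_fun fun m _ => gain_mono h m

theorem maxGain_zero (x : ℝ) : Q.maxGain 0 x = 0 := by
  obtain ⟨m, hm, h⟩ := Q.exists_gain_eq_maxGain 0 x
  rw [← h, eq_zero_of_mem_actions_zero hm, gain_zero]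

theorem maxGain_le_sum_abs (n : ℕ) (x : ℝ) :
    Q.maxGain n x ≤ ∑ k, (Q.M k : ℝ) * |Q.mu k * x - Q.c k| :=
  Finset.sup'_le _ _ fun _ hm => gain_le_sum_abs (mem_actions.1 hm).1 x

variable (Q) in
/-- The increase in the largest gain brought by one more customer. -/
def marginalGain (n : ℕ) (x : ℝ) : ℝ := Q.maxGain (n + 1) x - Q.maxGain n x

/-- Exchange argument: a server that works in an optimal action for `n + 2` customers, but not in
one for `n` customers, is moved from the former to the latter. -/
theorem marginalGain_succ_le (n : ℕ) (h : y ≤ x) :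
    Q.marginalGain (n + 1) y ≤ Q.marginalGain n x := by
  suffices Q.maxGain (n + 2) y + Q.maxGain n x ≤ Q.maxGain (n + 1) x + Q.maxGain (n + 1) y by
    rw [marginalGain, marginalGain]
    linarith
  obtain ⟨p, hp, hpy⟩ := Q.exists_gain_eq_maxGain (n + 2) y
  obtain ⟨q, hq, hqx⟩ := Q.exists_gain_eq_maxGain n x
  rw [← hpy, ← hqx]
  by_cases hle : total p ≤ n + 1
  · linarith [gain_le_maxGain (mem_actions.2 ⟨(mem_actions.1 hp).1, hle⟩) y,
      gain_le_maxGain (actions_mono n.le_succ hq) x]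
  · obtain ⟨k, -, hk⟩ : ∃ k ∈ Finset.univ, q k < p k :=
      Finset.exists_lt_of_sum_lt ((mem_actions.1 hq).2.trans_lt (by rw [total] at hle; omega))
    obtain ⟨r, rfl⟩ := exists_eq_add_single (Nat.ne_zero_of_lt hk)
    have hr := gain_le_maxGain (mem_actions_of_add_single_mem hp) y
    have hqk := gain_le_maxGain
      (add_single_mem_actions hq (hk.trans_le ((mem_actions.1 hp).1 k))) x
    rw [gain_add, gain_single] at hqk ⊢
    linarith [mul_le_mul_of_nonneg_left h (Q.mu_pos k).le]

/-! ### The chain of a policy and the optimality equation -/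

variable (Q) in
theorem isEfficient_iff {d : ℕ → Fin K → ℕ} : Q.IsEfficient d ↔ ∀ n, d n ∈ Q.actions n :=
  forall_congr' fun _ => mem_actions.symm

variable {d d' : ℕ → Fin K → ℕ} {G G' g : ℕ → ℝ} {η : ℝ}

theorem gain_eq_sub (x : ℝ) (m : Fin K → ℕ) :
    Q.gain x m = Q.rate m * x - ∑ k, (m k : ℝ) * Q.c k := by
  simp only [gain, rate, mul_sub, Finset.sum_sub_distrib, Finset.sum_mul, mul_assoc]

theorem IsPotential.lam_mul_prf (hg : Q.IsPotential d η g) (n : ℕ) :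
    Q.lam * prf g (n + 1) = η - Q.h n + Q.gain (prf g n) (d n) := by
  have h := hg n
  rw [cost, gen] at h
  rw [gain_eq_sub, prf, prf, Nat.add_sub_cancel]
  linear_combination h

namespace IsEfficient

theorem mem_actions (hd : Q.IsEfficient d) (n : ℕ) : d n ∈ Q.actions n :=
  Q.isEfficient_iff.1 hd n

theorem zero (hd : Q.IsEfficient d) : d 0 = 0 := eq_zero_of_mem_actions_zero (hd.mem_actions 0)

/-- The number of customers under an efficient policy, as a birth-death chain. -/
def chain (hd : Q.IsEfficient d) : BirthDeathChain where
  birth _ := Q.lam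
  death n := Q.rate (d n)
  bound := Q.unifRate
  birth_pos _ := Q.lam_pos
  death_nonneg n := Q.rate_nonneg (d n)
  death_zero := by simp [hd.zero, rate]
  birth_add_death_le n := add_le_add_right (Finset.sum_le_sum fun k _ =>
    mul_le_mul_of_nonneg_right (Nat.cast_le.2 ((hd n).1 k)) (Q.mu_pos k).le) _

theorem hasAverageCost_iff (hd : Q.IsEfficient d) : Q.HasAverageCost d η ↔
    ∀ i, hd.chain.HasTimeAverage (fun n => Q.cost n (d n)) i η :=
  forall_congr' fun _ => ⟨fun h => ⟨h.1, h.2.1, h.2.2⟩, fun h => ⟨h.1, h.2, h.3⟩⟩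

theorem residual_chain (hd : Q.IsEfficient d) (η : ℝ) (G : ℕ → ℝ) (n : ℕ) :
    hd.chain.residual (fun n => Q.cost n (d n)) η G n =
      Q.lam * G (n + 1) - (η - Q.h n + Q.gain (G n) (d n)) := by
  rw [BirthDeathChain.residual, cost, gain_eq_sub]
  simp only [chain]
  ring

theorem tendsto_cost (hd : Q.IsEfficient d) : Tendsto (fun n => Q.cost n (d n)) atTop atTop := by
  refine tendsto_atTop_mono (fun n => ?_)
    (tendsto_atTop_add_const_right _ (-∑ k, (Q.M k : ℝ) * |Q.c k|) Q.h_tendsto)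
  rw [cost, ← Finset.sum_neg_distrib]
  gcongr with k
  calc -((Q.M k : ℝ) * |Q.c k|) ≤ -((d n k : ℝ) * |Q.c k|) := by gcongr; exact (hd n).1 k
    _ = (d n k : ℝ) * -|Q.c k| := (mul_neg _ _).symm
    _ ≤ (d n k : ℝ) * Q.c k := by gcongr; exact neg_abs_le _

theorem exists_isStationary (hd : Q.IsEfficient d) (hη : Q.HasAverageCost d η) :
    ∃ w, hd.chain.IsStationary w ∧ (Summable fun n => w n * Q.cost n (d n)) ∧
      η = BirthDeathChain.mean w fun n => Q.cost n (d n) := by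
  have havg := hd.hasAverageCost_iff.1 hη
  obtain ⟨w, hw, hf⟩ := (havg 0).exists_isStationary hd.tendsto_cost
  obtain ⟨i, hi⟩ := hw.exists_pos
  exact ⟨w, hw, hf, tendsto_nhds_unique (havg i).tendsto (hw.hasTimeAverage hf hi).tendsto⟩

theorem eventually_rate_pos (hd : Q.IsEfficient d) (hη : Q.HasAverageCost d η) :
    ∀ᶠ n in atTop, 0 < Q.rate (d n) := by
  obtain ⟨w, hw, -⟩ := hd.exists_isStationary hη
  obtain ⟨i, hi⟩ := hw.exists_pos
  filter_upwards [eventually_gt_atTop i] with n hn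
  obtain ⟨n, rfl⟩ := Nat.exists_eq_add_one.2 (Nat.zero_lt_of_lt hn)
  exact (hw.pos_of_pos (hw.pos_of_le (Nat.le_of_lt_succ hn) hi)).1

theorem eventually_prf_nonneg (hd : Q.IsEfficient d) (hη : Q.HasAverageCost d η)
    (hg : Q.IsPotential d η g) : ∀ᶠ n in atTop, 0 ≤ prf g n := by
  obtain ⟨w, hw, hf, rfl⟩ := hd.exists_isStationary hη
  exact hw.eventually_nonneg_of_residual_eq_zero hf hd.tendsto_cost fun n => by
    rw [hd.residual_chain, hg.lam_mul_prf, sub_self]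

end IsEfficient

theorem IsOptimal.lam_mul_eq_of_le (hd : Q.IsOptimal d) (hη : Q.HasAverageCost d η)
    (hg : Q.IsPotential d η g) (hd' : Q.IsEfficient d') (hpos : ∀ n, 0 < Q.rate (d' (n + 1)))
    (hdd : d' =ᶠ[atTop] d) (hGG : G' =ᶠ[atTop] prf g)
    (hle : ∀ n, Q.lam * G' (n + 1) ≤ η - Q.h n + Q.gain (G' n) (d' n)) (n : ℕ) :
    Q.lam * G' (n + 1) = η - Q.h n + Q.gain (G' n) (d' n) := by
  obtain ⟨heff, η₀, hη₀, hmin⟩ := hd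
  obtain rfl : η₀ = η := tendsto_nhds_unique (hη₀ 0).2.2 (hη 0).2.2
  refine (hle n).eq_of_not_lt fun hlt => ?_
  obtain ⟨w, hw, hf, rfl⟩ := heff.exists_isStationary hη
  obtain ⟨η', hη', havg⟩ := hw.exists_lt_hasTimeAverage (C' := hd'.chain) hf
    (fun n => by rw [heff.residual_chain, hg.lam_mul_prf, sub_self]) .rfl
    (hdd.fun_comp Q.rate) (hdd.mono fun n hn => congrArg (Q.cost n) hn) hGG hpos
    (fun n => (hd'.residual_chain _ G' n).trans_le (sub_nonpos.2 (hle n)))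
    ((hd'.residual_chain _ G' n).trans_lt (sub_neg.2 hlt))
  exact hη'.not_ge (hmin d' η' hd' (hd'.hasAverageCost_iff.2 havg))

/-! ### Optimal actions maximize the gain -/

/-- Group `k` has servers, and none is cheaper per unit of work than its servers. -/
structure IsCheapest (Q : GroupServerQueue K) (k : Fin K) : Prop where
  servers_pos : 0 < Q.M k
  le : ∀ j, 0 < Q.M j → Q.c k / Q.mu k ≤ Q.c j / Q.mu j

theorem exists_isCheapest (h : ∃ k, 0 < Q.M k) : ∃ k, Q.IsCheapest k := by
  obtain ⟨k₀, hk₀⟩ := h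
  obtain ⟨k, hk, hmin⟩ := Finset.exists_min_image (Finset.univ.filter fun k => 0 < Q.M k)
    (fun k => Q.c k / Q.mu k) ⟨k₀, by simpa using hk₀⟩
  exact ⟨k, by simpa using hk, fun j hj => hmin j (by simpa using hj)⟩

theorem IsEfficient.exists_isCheapest (hd : Q.IsEfficient d) (hη : Q.HasAverageCost d η) :
    ∃ k, Q.IsCheapest k := by
  obtain ⟨n, hn⟩ := (hd.eventually_rate_pos hη).exists
  obtain ⟨k, hk⟩ := Function.ne_iff.1 (Q.rate_pos_iff.1 hn)
  exact GroupServerQueue.exists_isCheapest ⟨k, (Nat.pos_of_ne_zero hk).trans_le ((hd n).1 k)⟩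

theorem IsCheapest.gain_nonpos (hk : Q.IsCheapest k) (hx : x ≤ Q.c k / Q.mu k) (hm : m ≤ Q.M) :
    Q.gain x m ≤ 0 := by
  refine Finset.sum_nonpos fun j _ => ?_
  rcases Nat.eq_zero_or_pos (m j) with hj | hj
  · simp [hj]
  · have hxj := (le_div_iff₀ (Q.mu_pos j)).1 (hx.trans (hk.le j (hj.trans_le (hm j))))
    exact mul_nonpos_of_nonneg_of_nonpos (Nat.cast_nonneg _) (by linarith)

/-- The policy under which a single server of group `k` works in the states `1, …, N`, and which
agrees with `d` in all other states. -/
def soloUpTo (d : ℕ → Fin K → ℕ) (k : Fin K) (N n : ℕ) : Fin K → ℕ :=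
  if n = 0 ∨ N < n then d n else Pi.single k 1

theorem soloUpTo_of_lt {N : ℕ} (h : N < n) : soloUpTo d k N n = d n := if_pos (.inr h)

theorem soloUpTo_succ_of_le {N : ℕ} (h : n ≤ N) : soloUpTo d k (N + 1) (n + 1) = Pi.single k 1 :=
  if_neg (by omega)

theorem IsEfficient.soloUpTo (hd : Q.IsEfficient d) (hk : 0 < Q.M k) (N : ℕ) :
    Q.IsEfficient (soloUpTo d k N) := by
  refine Q.isEfficient_iff.2 fun n => ?_
  rw [GroupServerQueue.soloUpTo]
  split_ifs with h
  · exact hd.mem_actions n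
  · obtain ⟨n, rfl⟩ := Nat.exists_eq_add_one.2 (Nat.pos_of_ne_zero fun hn => h (.inl hn))
    exact single_mem_actions hk n

theorem IsEfficient.gain_soloUpTo (hd : Q.IsEfficient d) (k : Fin K) {N : ℕ} (hn : n ≤ N) :
    Q.gain (Q.c k / Q.mu k) (GroupServerQueue.soloUpTo d k N n) = 0 := by
  rw [GroupServerQueue.soloUpTo]
  split_ifs with h
  · rw [h.resolve_right hn.not_gt, hd.zero, gain_zero]
  · rw [gain_single, mul_div_cancel₀ _ (Q.mu_pos k).ne', sub_self]

section Recursion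

variable {r : ℕ → ℝ} (hG : ∀ᶠ n in atTop, 0 ≤ G n)
include hG

theorem exists_lt_of_recursion (hrec : ∀ n, Q.lam * G (n + 1) = η - Q.h n + r n) (b : ℝ) (N : ℕ) :
    ∃ n ≥ N, b < r n := by
  obtain ⟨n, hn, hGn, hh⟩ := ((eventually_ge_atTop N).and
    (((tendsto_add_atTop_nat 1).eventually hG).and
      (Q.h_tendsto.eventually_gt_atTop (η + b)))).exists
  exact ⟨n, hn, by linarith [hrec n, mul_nonneg Q.lam_pos.le hGn]⟩

variable (hd : Q.IsEfficient d)
  (hrec : ∀ n, Q.lam * G (n + 1) = η - Q.h n + Q.gain (G n) (d n)) (hk : Q.IsCheapest k)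
include hd hrec hk

theorem IsCheapest.lt_of_sub_le {N : ℕ} (hN : η - Q.h N ≤ Q.lam * (Q.c k / Q.mu k)) :
    Q.c k / Q.mu k < G N := by
  by_contra! hle
  have hgain {n : ℕ} (h : G n ≤ Q.c k / Q.mu k) : Q.gain (G n) (d n) ≤ 0 :=
    hk.gain_nonpos h (hd n).1
  have hstay : ∀ n ≥ N, G n ≤ Q.c k / Q.mu k := by
    intro n hn
    induction n, hn using Nat.le_induction with
    | base => exact hle
    | succ n hn ih =>
      refine le_of_mul_le_mul_left ?_ Q.lam_pos
      linarith [hrec n, hgain ih, Q.h_mono hn]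
  obtain ⟨n, hn, hpos⟩ := exists_lt_of_recursion hG hrec 0 N
  exact hpos.not_ge (hgain (hstay n hn))

theorem IsCheapest.lt_succ_of_gain_nonneg {n : ℕ} (hn : 0 ≤ Q.gain (G n) (d n)) :
    Q.c k / Q.mu k < G (n + 1) := by
  by_contra! hle
  refine hle.not_gt (hk.lt_of_sub_le hG hd hrec ?_)
  linarith [hrec n, Q.h_mono n.le_succ, mul_le_mul_of_nonneg_left hle Q.lam_pos.le]

end Recursion

section Optimal

variable (hd : Q.IsOptimal d) (hη : Q.HasAverageCost d η) (hg : Q.IsPotential d η g)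
include hd hη hg

/-- Otherwise let one cheapest server work in the states up to `N + 1`, and replace the increments
of the potential there by its cost per unit of work: the gain of the new actions vanishes, and the
new policy improves on `d`. -/
theorem IsOptimal.rate_pos_of_forall_gt {N : ℕ} (hbusy : ∀ n > N + 1, 0 < Q.rate (d n)) :
    0 < Q.rate (d (N + 1)) := by
  by_contra hidle
  obtain ⟨k, hk⟩ := hd.1.exists_isCheapest hη
  have hgain : Q.gain (prf g (N + 1)) (d (N + 1)) = 0 := by
    rw [Q.rate_pos_iff.not_left.1 hidle, gain_zero]
  have hlast := mul_lt_mul_of_pos_left (hk.lt_succ_of_gain_nonneg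
    (hd.1.eventually_prf_nonneg hη hg) hd.1 hg.lam_mul_prf hgain.ge) Q.lam_pos
  rw [hg.lam_mul_prf, hgain, add_zero] at hlast
  let G' (n : ℕ) : ℝ := if n ≤ N + 1 then Q.c k / Q.mu k else prf g n
  have hG'_le {n : ℕ} (hn : n ≤ N + 1) : G' n = Q.c k / Q.mu k := if_pos hn
  have hG'_gt {n : ℕ} (hn : N + 1 < n) : G' n = prf g n := if_neg hn.not_ge
  have hsolo {n : ℕ} (hn : n ≤ N + 1) : Q.gain (G' n) (soloUpTo d k (N + 1) n) = 0 := by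
    rw [hG'_le hn, hd.1.gain_soloUpTo k hn]
  have hrate (n : ℕ) : 0 < Q.rate (soloUpTo d k (N + 1) (n + 1)) := by
    rcases le_or_gt n N with hn | hn
    · exact Q.rate_pos_iff.2 (by simp [soloUpTo_succ_of_le, hn])
    · rw [soloUpTo_of_lt (Nat.succ_lt_succ hn)]
      exact hbusy _ (Nat.succ_lt_succ hn)
  have hle (n : ℕ) :
      Q.lam * G' (n + 1) ≤ η - Q.h n + Q.gain (G' n) (soloUpTo d k (N + 1) n) := by
    rcases lt_trichotomy n (N + 1) with hn | rfl | hn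
    · rw [hsolo hn.le, hG'_le hn]
      linarith [Q.h_mono hn.le]
    · rw [hsolo le_rfl, hG'_gt (Nat.lt_succ_self _), hg.lam_mul_prf, hgain]
    · rw [hG'_gt hn, soloUpTo_of_lt hn, hG'_gt (hn.trans n.lt_succ_self), hg.lam_mul_prf]
  have heq := hd.lam_mul_eq_of_le hη hg (hd.1.soloUpTo hk.servers_pos (N + 1)) hrate
    ((eventually_gt_atTop (N + 1)).mono fun _ => soloUpTo_of_lt)
    ((eventually_gt_atTop (N + 1)).mono fun _ => hG'_gt) hle 0
  rw [hsolo (Nat.zero_le _), hG'_le (Nat.succ_le_succ N.zero_le)] at heq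
  linarith [Q.h_mono (Nat.zero_le (N + 1))]

theorem IsOptimal.rate_pos (n : ℕ) : 0 < Q.rate (d (n + 1)) := by
  obtain ⟨N, hN⟩ := eventually_atTop.1 (hd.1.eventually_rate_pos hη)
  suffices hbusy : ∀ n > 0, 0 < Q.rate (d n) from hbusy (n + 1) n.succ_pos
  refine Nat.decreasingInduction (motive := fun m _ => ∀ n > m, 0 < Q.rate (d n))
    (fun m _ ih n hn => ?_) (fun n hn => hN n hn.le) N.zero_le
  rcases (Nat.succ_le_of_lt hn).eq_or_lt with rfl | hlt
  · exact hd.rate_pos_of_forall_gt hη hg ih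
  · exact ih n hlt

theorem IsOptimal.gain_le_of_rate_pos (n : ℕ) (hm : m ∈ Q.actions (n + 1)) (hpos : 0 < Q.rate m) :
    Q.gain (prf g (n + 1)) m ≤ Q.gain (prf g (n + 1)) (d (n + 1)) := by
  by_contra! hlt
  have hact (j : ℕ) : Function.update d (n + 1) m j ∈ Q.actions j := by
    rcases eq_or_ne j (n + 1) with rfl | hj
    · rwa [Function.update_self]
    · rw [Function.update_of_ne hj]
      exact hd.1.mem_actions j
  have hrate (j : ℕ) : 0 < Q.rate (Function.update d (n + 1) m (j + 1)) := by
    rcases eq_or_ne (j + 1) (n + 1) with hj | hj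
    · rwa [hj, Function.update_self]
    · rw [Function.update_of_ne hj]
      exact hd.rate_pos hη hg j
  have hle (j : ℕ) : Q.lam * prf g (j + 1) ≤
      η - Q.h j + Q.gain (prf g j) (Function.update d (n + 1) m j) := by
    rw [hg.lam_mul_prf]
    rcases eq_or_ne j (n + 1) with rfl | hj
    · rw [Function.update_self]
      linarith
    · rw [Function.update_of_ne hj]
  have hev : Function.update d (n + 1) m =ᶠ[atTop] d :=
    (eventually_gt_atTop (n + 1)).mono fun j hj => Function.update_of_ne hj.ne' _ _
  have heq := hd.lam_mul_eq_of_le hη hg (Q.isEfficient_iff.2 hact) hrate hev .rfl hle (n + 1)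
  rw [hg.lam_mul_prf, Function.update_self] at heq
  linarith

theorem IsOptimal.gain_pos (hk : Q.IsCheapest k) (n : ℕ) :
    0 < Q.gain (prf g (n + 1)) (d (n + 1)) := by
  have hstep {n : ℕ} (h : 0 ≤ Q.gain (prf g n) (d n)) : Q.c k / Q.mu k < prf g (n + 1) :=
    hk.lt_succ_of_gain_nonneg (hd.1.eventually_prf_nonneg hη hg) hd.1 hg.lam_mul_prf h
  have hpos {n : ℕ} (h : Q.c k / Q.mu k < prf g (n + 1)) :
      0 < Q.gain (prf g (n + 1)) (d (n + 1)) := by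
    refine lt_of_lt_of_le ?_ (hd.gain_le_of_rate_pos hη hg n
      (single_mem_actions hk.servers_pos n) (Q.rate_pos_iff.2 (by simp)))
    rw [gain_single, sub_pos, ← div_lt_iff₀' (Q.mu_pos k)]
    exact h
  induction n with
  | zero => exact hpos (hstep (by rw [hd.1.zero, gain_zero]))
  | succ n ih => exact hpos (hstep ih.le)

theorem IsOptimal.isMaxOn_gain (n : ℕ) : IsMaxOn (Q.gain (prf g n)) (Q.actions n) (d n) := by
  intro m hm
  obtain ⟨k, hk⟩ := hd.1.exists_isCheapest hη
  cases n with
  | zero => exact (by rw [eq_zero_of_mem_actions_zero hm, hd.1.zero] :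
      Q.gain (prf g 0) m = Q.gain (prf g 0) (d 0)).le
  | succ n =>
    rcases eq_or_ne m 0 with rfl | hne
    · exact (gain_zero _).trans_le (hd.gain_pos hη hg hk n).le
    · exact hd.gain_le_of_rate_pos hη hg n hm (Q.rate_pos_iff.2 hne)

end Optimal

/-! ### Monotonicity of the realization factors -/

section Monotone

variable (hrec : ∀ n, Q.lam * G (n + 1) = η - Q.h n + Q.maxGain n (G n))
include hrec

theorem marginalGain_le_of_descent (hn : n = 0 ∨ G n ≤ G (n + 1)) (h : G (n + 2) ≤ G (n + 1)) :
    Q.marginalGain n (G (n + 1)) ≤ Q.h (n + 1) - Q.h n := by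
  have hmax : Q.maxGain n (G n) ≤ Q.maxGain n (G (n + 1)) := by
    rcases hn with rfl | hn
    · rw [maxGain_zero, maxGain_zero]
    · exact monotone_maxGain n hn
  rw [marginalGain]
  linarith [hrec n, hrec (n + 1), mul_le_mul_of_nonneg_left h Q.lam_pos.le]

theorem descent_succ (h : G (n + 2) ≤ G (n + 1))
    (hmarg : Q.marginalGain n (G (n + 1)) ≤ Q.h (n + 1) - Q.h n) : G (n + 3) ≤ G (n + 2) := by
  have hsucc := (marginalGain_succ_le n le_rfl).trans hmarg
  rw [marginalGain] at hsucc
  refine le_of_mul_le_mul_left ?_ Q.lam_pos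
  linarith [hrec (n + 1), hrec (n + 2), monotone_maxGain (Q := Q) (n + 2) h, Q.h_convex n]

/-- A first descent would persist, since by convexity of `h` the marginal gain stays below the
marginal holding cost; so `G` would be bounded above, and hence so would the gains. -/
theorem strictMono_of_recursion (hG : ∀ᶠ n in atTop, 0 ≤ G n) : StrictMono fun n => G (n + 1) := by
  refine strictMono_nat_of_lt_succ fun n => ?_
  induction n using Nat.strong_induction_on with | _ n ih
  by_contra! hn
  have hfirst : n = 0 ∨ G n ≤ G (n + 1) := by
    cases n with
    | zero => exact .inl rfl
    | succ n => exact .inr (ih n n.lt_succ_self).le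
  have hdescent : ∀ q ≥ n, G (q + 2) ≤ G (q + 1) ∧
      Q.marginalGain q (G (q + 1)) ≤ Q.h (q + 1) - Q.h q := by
    intro q hq
    induction q, hq using Nat.le_induction with
    | base => exact ⟨hn, marginalGain_le_of_descent hrec hfirst hn⟩
    | succ q _ ih => exact ⟨descent_succ hrec ih.1 ih.2,
        (marginalGain_succ_le q ih.1).trans (ih.2.trans (Q.h_convex q))⟩
  have hbound : ∀ q ≥ n + 1, G q ≤ G (n + 1) := by
    intro q hq
    induction q, hq using Nat.le_induction with
    | base => exact le_rfl
    | succ q hq ih =>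
      obtain ⟨q, rfl⟩ := Nat.exists_eq_add_one.2 (Nat.zero_lt_of_lt hq)
      exact (hdescent q (Nat.le_of_succ_le_succ hq)).1.trans ih
  obtain ⟨q, hq, hlt⟩ := exists_lt_of_recursion hG hrec _ (n + 1)
  exact hlt.not_ge ((monotone_maxGain q (hbound q hq)).trans (maxGain_le_sum_abs q _))

end Monotone

theorem IsOptimal.strictMono_prf (hd : Q.IsOptimal d) (hη : Q.HasAverageCost d η)
    (hg : Q.IsPotential d η g) : StrictMono fun n => prf g (n + 1) :=
  strictMono_of_recursion (fun n => by
    rw [hg.lam_mul_prf, gain_eq_maxGain (hd.isMaxOn_gain hη hg n) (hd.1.mem_actions n)])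
    (hd.1.eventually_prf_nonneg hη hg)

end GroupServerQueue

end

theorem theorem6 {K : ℕ} (Q : GroupServerQueue K) (d : ℕ → Fin K → ℕ) (η : ℝ) (g : ℕ → ℝ)
    (hd : Q.IsOptimal d) (hη : Q.HasAverageCost d η) (hg : Q.IsPotential d η g) :
    (∀ n, GroupServerQueue.total (d n) ≤ GroupServerQueue.total (d (n + 1))) ∧
    (∀ n, (∀ k, GroupServerQueue.prf g n = Q.c k / Q.mu k → d n k = 0) →
      GroupServerQueue.total (d n) =
        min n (∑ k with GroupServerQueue.prf g n > Q.c k / Q.mu k, Q.M k)) ∧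
    (∀ n,
      min n (∑ k with GroupServerQueue.prf g n > Q.c k / Q.mu k, Q.M k) ≤
        GroupServerQueue.total (d n) ∧
      GroupServerQueue.total (d n) ≤
        min n (∑ k with GroupServerQueue.prf g n ≥ Q.c k / Q.mu k, Q.M k)) := by
  have hmem (n : ℕ) := hd.1.mem_actions n
  have hmax (n : ℕ) := hd.isMaxOn_gain hη hg n
  have hlow (n : ℕ) := GroupServerQueue.le_total_of_isMaxOn_gain (hmax n) (hmem n)
  have hup (n : ℕ) := GroupServerQueue.total_le_of_eq_zero
    (P := fun k => GroupServerQueue.prf g n ≥ Q.c k / Q.mu k) (hmem n) fun k hk =>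
      GroupServerQueue.eq_zero_of_isMaxOn_gain (hmax n) (hmem n) (not_le.1 hk)
  refine ⟨fun n => ?_, fun n htie => ?_, fun n => ⟨hlow n, hup n⟩⟩
  · cases n with
    | zero => exact (hd.1 0).2.trans (Nat.zero_le _)
    | succ n =>
      have hlt := hd.strictMono_prf hη hg n.lt_succ_self
      refine (hup (n + 1)).trans (le_trans (min_le_min (n + 1).le_succ ?_) (hlow (n + 2)))
      exact Finset.sum_le_sum_of_subset
        (Finset.monotone_filter_right _ fun k _ hk => hk.trans_lt hlt)
  · refine (GroupServerQueue.total_le_of_eq_zero (hmem n) fun k hk => ?_).antisymm (hlow n)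
    rcases (not_lt.1 hk).lt_or_eq with hlt | heq
    · exact GroupServerQueue.eq_zero_of_isMaxOn_gain (hmax n) (hmem n) hlt
    · exact htie k heq
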